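/- Let $G=(V,E,\mathcal P,(V_\Diamond,V_\square))$ be a finite parity game: $V$ is a finite set partitioned into the vertices $V_\Diamond$ owned by player $\Diamond$ (even) and the vertices $V_\square$ owned by player $\square$ (odd), every vertex has at least one successor under $E$, and $\mathcal P\colon V\to\mathbb N$ assigns priorities. A play is an infinite path; it is won by $\Diamond$ if the least priority occurring infinitely often on it is even, and by $\square$ otherwise. Write $v^\bullet$ for the set of successors of $v$ and $V_i$ for the set of vertices of priority $i$. A $\square$-strategy (a partial function assigning to histories ending in a $\square$-vertex a successor of that vertex) is winning on $D\subseteq V$ if every play that starts in $D$ and is consistent with it is won by $\square$, and closed on $D$ if no such play leaves $D$. A $\square$-dominion is a set $D$ on which some $\square$-strategy is both winning and closed. A positional $\square$-strategy is a function $\sigma\colon V_\square\to V$ with $\sigma(w)\in w^\bullet$. *Small progress measures (SPM).* Let $d=1+\max_{v}\mathcal P(v)$, and let $\mathbb M^\Diamond$ consist of an element $\top$ and all tuples $(m_0,\dots,m_{d-1})\in\mathbb N^d$ with $m_i=0$ for even $i$ and $m_i\le |V_i|$ for odd $i$, ordered lexicographically, with $\top$ as the largest element. Write $\ge_i$ and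 $>_i$ for the comparison of tuples restricted to positions $0,\dots,i$, again with $\top$ above all tuples (and $\top\ge_i\top$). For $\rho\colon V\to\mathbb M^\Diamond$ and $w\in v^\bullet$, let $\mathrm{Prog}(\rho,v,w)$ be the least $m\in\mathbb M^\Diamond$ such that $m\ge_{\mathcal P(v)}\rho(w)$ if $\mathcal P(v)$ is even, and such that $m>_{\mathcal P(v)}\rho(w)$ or $m=\rho(w)=\top$ if $\mathcal P(v)$ is odd. Let $\mathrm{Lift}(\rho,v)$ be $\rho$ with the value at $v$ replaced by $\max\{\rho(v),\min_{w\in v^\bullet}\mathrm{Prog}(\rho,v,w)\}$ if $v\in V_\Diamond$, and by $\max\{\rho(v),\max_{w\in v^\bullet}\mathrm{Prog}(\rho,v,w)\}$ if $v\in V_\square$. A lifting sequence starts with the constant function $(0,\dots,0)$ and repeatedly replaces $\rho$ by $\mathrm{Lift}(\rho,w)$ for an arbitrary $w$ for which this strictly increases $\rho$. *Guarded attractor.* For a vertex $v$ of priority $k$, let $A=\mathrm{Attr}^{\ge k}_\square(\{v\})$ be the least set of vertices that contains $v$, every $w\in V_\square$ with $\mathcal P(w)\ge k$ and $w^\bullet\cap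 A\ne\emptyset$, and every $w\in V_\Diamond$ with $\mathcal P(w)\ge k$ and $w^\bullet\subseteq A$. A positional $\square$-strategy $\tau$ *attracts towards $v$ in $A$* if every play that starts in $A$ and is consistent with $\tau$ reaches $v$ and does not leave $A$ before doing so. **Theorem.** Consider an arbitrary lifting sequence on $G$ in which at some point a vertex $v$ is the first vertex whose measure becomes $\top$. Let $k=\mathcal P(v)$, let $\rho$ be the measure function immediately after that lifting, and let $A=\mathrm{Attr}^{\ge k}_\square(\{v\})$. Then there is a positional $\square$-strategy attracting towards $v$ in $A$, and the following holds. 1. If $v\in V_\square$, then for every $u\in v^\bullet$ with $\rho(u')\le\rho(u)$ for all $u'\in v^\bullet$ there is a $\square$-dominion $D_u\supseteq A$ all of whose vertices have priority $\ge k$, such that for every positional $\square$-strategy $\tau$ attracting towards $v$ in $A$ there is a positional $\square$-strategy $\sigma$ that is winning and closed on $D_u$, satisfies $\sigma(v)=u$, and agrees with $\tau$ on $V_\square\cap (A\setminus\{v\})$. 2. If $v\in V_\Diamond$, then there is a $\square$-dominion $D\supseteq A$ all of whose vertices have priority $\ge k$, with $v^\bullet\subseteq D$, such that for every positional $\square$-strategy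 $\tau$ attracting towards $v$ in $A$ there is a positional $\square$-strategy $\sigma$ that is winning and closed on $D$ and agrees with $\tau$ on $V_\square\cap (A\setminus\{v\})$. -/

import Mathlib

/-- The two players: `even` is player `◇`, `odd` is player `□`. -/
inductive Player where
  | even
  | odd

/-- A parity game on the vertex set `V` (finiteness of `V` is a separate `Fintype` assumption).
The owner function encodes the partition of `V` into `V_◇` and `V_□`. -/
structure ParityGame (V : Type*) where
  /-- The edge relation. -/
  E : V → V → Prop
  /-- Every vertex has at least one outgoing edge. -/
  total : ∀ v, ∃ w, E v w
  /-- The priority of a vertex. -/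
  prio : V → ℕ
  /-- The player who owns a vertex. -/
  owner : V → Player

noncomputable section

namespace ParityGame

variable {V : Type*} (G : ParityGame V)

/-! ### Plays and strategies -/

/-- A play is an infinite path in the game graph. -/
def IsPlay (π : ℕ → V) : Prop := ∀ n, G.E (π n) (π (n + 1))

/-- The least priority that occurs infinitely often on an infinite sequence of vertices. -/
def leastInfPrio (π : ℕ → V) : ℕ :=
  sInf {p | ∃ᶠ n in Filter.atTop, G.prio (π n) = p}

/-- `G.WonBy i π`: the play `π` is won by player `i`. -/
def WonBy (i : Player) (π : ℕ → V) : Prop :=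
  match i with
  | Player.even => Even (G.leastInfPrio π)
  | Player.odd => ¬ Even (G.leastInfPrio π)

/-- The finite prefix `π 0, …, π n` of a sequence. -/
def playPrefix (π : ℕ → V) (n : ℕ) : List V := (List.range (n + 1)).map π

/-- A (history dependent) strategy for player `i`: a partial function from finite sequences of
vertices to vertices; if it is defined on a finite path ending in `w`, then `w` is owned by `i` and
the prescribed vertex is a successor of `w`. -/
structure Strategy (i : Player) where
  /-- The move prescribed after a history, if any. -/
  move : List V → Option V
  /-- Only the moves of player `i` are prescribed, and they follow edges. -/
  legal : ∀ (h : List V) (w x : V), (h ++ [w]).IsChain G.E → move (h ++ [w]) = some x →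
    G.owner w = i ∧ G.E w x

/-- A positional strategy for player `i`: a function on the vertices owned by `i` that chooses a
successor. -/
structure PosStrategy (i : Player) where
  /-- The chosen successor. -/
  move : ∀ w : V, G.owner w = i → V
  /-- The choice follows an edge. -/
  legal : ∀ (w : V) (hw : G.owner w = i), G.E w (move w hw)

variable {G}

open Classical in
/-- A positional strategy, seen as a strategy: it looks at the last vertex of the history only. -/
def PosStrategy.toStrategy {i : Player} (σ : G.PosStrategy i) : G.Strategy i where
  move h := h.getLast?.bind fun w => if hw : G.owner w = i then some (σ.move w hw) else none
  legal := by
    intro h w x _ hx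
    simp only [List.getLast?_append, List.getLast?_singleton, Option.some_or,
      Option.bind_some] at hx
    split_ifs at hx with hw
    exact ⟨hw, by rw [← Option.some.inj hx]; exact σ.legal w hw⟩

/-- The sequence `π` is consistent with the strategy `σ`. -/
def Strategy.Consistent {i : Player} (σ : G.Strategy i) (π : ℕ → V) : Prop :=
  ∀ n x, σ.move (playPrefix π n) = some x → π (n + 1) = x

/-- The strategy `σ` of player `i` is winning from every vertex of `D`. -/
def Strategy.WinningOn {i : Player} (σ : G.Strategy i) (D : Set V) : Prop :=
  ∀ π, G.IsPlay π → π 0 ∈ D → σ.Consistent π → G.WonBy i π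

/-- The strategy `σ` is closed on `D`: plays that start in `D` and are consistent with `σ` never
leave `D`. -/
def Strategy.ClosedOn {i : Player} (σ : G.Strategy i) (D : Set V) : Prop :=
  ∀ π, G.IsPlay π → π 0 ∈ D → σ.Consistent π → ∀ n, π n ∈ D

variable (G)

/-- `D` is an `i`-dominion. -/
def IsDominion (i : Player) (D : Set V) : Prop :=
  ∃ σ : G.Strategy i, σ.WinningOn D ∧ σ.ClosedOn D

/-! ### Guarded attractors -/

/-- The guarded attractor `Attr^{≥ k}_□(U)` (for `U ⊆ V_{≥ k}`): the least set of vertices of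
priority `≥ k` that contains `U`, every `□`-vertex of priority `≥ k` with some successor in the set,
and every `◇`-vertex of priority `≥ k` with all successors in the set. -/
inductive GuardedAttr (k : ℕ) (U : Set V) : V → Prop
  | base (w : V) : w ∈ U → k ≤ G.prio w → GuardedAttr k U w
  | odd (w x : V) : k ≤ G.prio w → G.owner w = Player.odd → G.E w x → GuardedAttr k U x →
      GuardedAttr k U w
  | even (w : V) : k ≤ G.prio w → G.owner w = Player.even →
      (∀ x, G.E w x → GuardedAttr k U x) → GuardedAttr k U w

/-- The guarded attractor as a set. -/
def guardedAttr (k : ℕ) (U : Set V) : Set V := {w | G.GuardedAttr k U w}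

/-- The positional strategy `τ` attracts towards `U` inside `A`: every play that starts in `A` and
is consistent with `τ` reaches `U`, and does not leave `A` before. (Only the values of `τ` on
`A \ U` matter.) -/
def IsAttracting {i : Player} (τ : G.PosStrategy i) (A U : Set V) : Prop :=
  ∀ π, G.IsPlay π → π 0 ∈ A → τ.toStrategy.Consistent π → ∃ n, π n ∈ U ∧ ∀ m ≤ n, π m ∈ A

/-! ### Measures -/

variable [Fintype V]

/-- The length of tuples: one more than the largest priority that occurs. -/
def dim : ℕ := Finset.univ.sup G.prio + 1

/-- `|V_i|`, the number of vertices of priority `i`. -/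
def prioCount (i : ℕ) : ℕ := Set.ncard {w | G.prio w = i}

/-- The largest value that is allowed at position `i` of a tuple. -/
def bound (i : ℕ) : ℕ := if Even i then 0 else G.prioCount i

/-- The tuples in the measure domain, with the lexicographic order (position `0` is the most
significant one). -/
abbrev Tuple : Type := {α : Lex (Fin G.dim → ℕ) // ∀ i : Fin G.dim, ofLex α i ≤ G.bound i}

/-- The measure domain `𝕄^◇`: the tuples together with a top element `⊤`. -/
abbrev Meas : Type := WithTop G.Tuple

/-- The tuple `(0, …, 0)`. -/
def zeroTuple : G.Tuple := ⟨toLex fun _ => 0, fun _ => Nat.zero_le _⟩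

variable {G}

/-- Replace all entries after position `i` by `0`. -/
def truncTuple (i : ℕ) (α : G.Tuple) : G.Tuple :=
  ⟨toLex fun j => if (j : ℕ) ≤ i then ofLex α.1 j else 0, fun j => by
    change (if (j : ℕ) ≤ i then ofLex α.1 j else 0) ≤ G.bound j
    split_ifs
    · exact α.2 j
    · exact Nat.zero_le _⟩

/-- Truncation on measures; `⊤` stays `⊤`. -/
def trunc (i : ℕ) (m : G.Meas) : G.Meas := WithTop.map (truncTuple i) m

/-- `m ≤_i m'`: comparison of the entries up to and including position `i`, with `⊤` on top. -/
def LeUpTo (i : ℕ) (m m' : G.Meas) : Prop := trunc i m ≤ trunc i m'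

/-- `m <_i m'`: strict comparison of the entries up to and including position `i`, with `⊤` on
top. -/
def LtUpTo (i : ℕ) (m m' : G.Meas) : Prop := trunc i m < trunc i m'

/-- The condition on `m` in the definition of `Prog(ρ, v, w)`. -/
def ProgCond (ρ : V → G.Meas) (v w : V) (m : G.Meas) : Prop :=
  if Even (G.prio v) then LeUpTo (G.prio v) (ρ w) m
  else LtUpTo (G.prio v) (ρ w) m ∨ (m = ⊤ ∧ ρ w = ⊤)

variable (G)

theorem finite_tuple : Finite G.Tuple :=
  Finite.of_injective
    (fun (α : G.Tuple) (i : Fin G.dim) => (⟨ofLex α.1 i, Nat.lt_succ_of_le (α.2 i)⟩ :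
      Fin (G.bound i + 1)))
    (by
      intro α β h
      apply Subtype.ext
      funext i
      exact congrArg Fin.val (congrFun h i))

instance : Fintype G.Meas :=
  letI : Fintype G.Tuple := @Fintype.ofFinite _ G.finite_tuple
  inferInstanceAs (Fintype (Option G.Tuple))

variable {G}

open Classical in
/-- `Prog(ρ, v, w)`: the least measure that satisfies the condition; see `prog_isLeast`. -/
def prog (ρ : V → G.Meas) (v w : V) : G.Meas :=
  (Finset.univ.filter (ProgCond ρ v w)).inf id

theorem progCond_top (ρ : V → G.Meas) (v w : V) : ProgCond ρ v w ⊤ := by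
  unfold ProgCond LeUpTo LtUpTo
  have h : trunc (G.prio v) (⊤ : G.Meas) = ⊤ := rfl
  rw [h]
  split_ifs
  · exact le_top
  · by_cases hw : ρ w = ⊤
    · exact Or.inr ⟨rfl, hw⟩
    · left
      obtain ⟨a, ha⟩ := WithTop.ne_top_iff_exists.mp hw
      rw [← ha]
      exact WithTop.coe_lt_top _

theorem prog_isLeast (ρ : V → G.Meas) (v w : V) :
    IsLeast {m | ProgCond ρ v w m} (prog ρ v w) := by
  classical
  refine ⟨?_, fun m hm => Finset.inf_le (f := id) (by simpa using hm)⟩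
  obtain ⟨m, hm, h⟩ := Finset.exists_mem_eq_inf (Finset.univ.filter (ProgCond ρ v w))
    ⟨⊤, by simpa using progCond_top ρ v w⟩ id
  have : prog ρ v w = m := by
    unfold prog
    convert h using 2
    rfl
  rw [this]
  simpa using hm

variable (G)

open Classical in
/-- The finite set of successors of `v`. -/
def succs (v : V) : Finset V := Finset.univ.filter (G.E v)

theorem succs_nonempty (v : V) : (G.succs v).Nonempty := by
  classical
  obtain ⟨w, hw⟩ := G.total v
  exact ⟨w, by simpa [succs] using hw⟩

variable {G}

open Classical in
/-- The lifting operator `Lift(ρ, v)`. -/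
def lift (ρ : V → G.Meas) (v : V) : V → G.Meas :=
  Function.update ρ v <|
    match G.owner v with
    | Player.even => max (ρ v) ((G.succs v).inf' (G.succs_nonempty v) (prog ρ v))
    | Player.odd => max (ρ v) ((G.succs v).sup' (G.succs_nonempty v) (prog ρ v))

/-- One step of the small progress measures algorithm: a lifting at some vertex that strictly
increases the measure function. -/
def LiftStep (ρ ρ' : V → G.Meas) : Prop := ∃ w, ρ < lift ρ w ∧ ρ' = lift ρ w

/-- `v` is the first vertex whose measure becomes `⊤` in some lifting sequence that starts in the
all-zero measure function, and `ρ` is the measure function immediately after that lifting. -/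
def IsFirstTop (ρ : V → G.Meas) (v : V) : Prop :=
  ∃ ρ₀ : V → G.Meas,
    Relation.ReflTransGen LiftStep (fun _ => ((G.zeroTuple : G.Tuple) : G.Meas)) ρ₀ ∧
    (∀ w, ρ₀ w ≠ ⊤) ∧ ρ = lift ρ₀ v ∧ ρ v = ⊤

end ParityGame

end

/-! Let `v`, of priority `k`, be the first vertex lifted to `⊤`. At even priority `prog` never
exceeds the successor's measure, so `k` is odd. Consider the game in which `v` and all vertices of
priority `< k` become sinks, `v` keeping priority `k` and the others getting priority `0`. Thus `v`
is lost for `◇`, and the low sinks are lost for `□`. Determinacy splits this game into a region `X`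
of `◇` and a region `W` of `□`, each with a progress measure (`exists_hasMeasure_cover`, a
Zielonka-style recursion that builds measures instead of strategies). Every vertex of `W` has
priority `≥ k`, and `W` contains the guarded attractor of `v`, because `□` cannot leave `X`
(`guardedAttr_subset`).

The measure `ξ` of `◇` limits the liftings. As long as nothing is `⊤`, the measure of a vertex of
`X` is at most `sinkBound`: saturated before position `k` and equal to `ξ` from there on, or, at a
low sink, saturated up to its own priority and zero afterwards (`le_sinkBound`). The entries of `ξ`
count vertices of `X` only and `v ∉ X`, so position `k` never reaches `|V_k|`. Hence measures on `X`
stay below saturation up to `k` (`lt_satMeas`). A successor of `v` with progress value `⊤` is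
saturated up to `k` and so lies in `W`. If `□` owns `v`, this covers a successor of maximal measure;
if `◇` does, it covers all successors.

On `W`, player `□` moves from `v` to `u`, follows `τ` in the rest of the attractor, and follows its
progress measure elsewhere (`exists_winning_strategy`). If a play meets `v` infinitely often, its
least recurring priority is `k`, which is odd. Otherwise it eventually avoids the attractor and
follows the measure forever, so `□` wins. -/

/-! ### Truncated lexicographic comparison -/

/-- The first `N` entries of `a`, with those after position `p` replaced by `0`, in the
lexicographic order. -/
def truncLex (N p : ℕ) (a : ℕ → ℕ) : Lex (Fin N → ℕ) :=
  toLex fun j => if (j : ℕ) ≤ p then a j else 0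

theorem truncLex_add (N p : ℕ) (a c : ℕ → ℕ) :
    truncLex N p (a + c) = truncLex N p a + truncLex N p c := by
  apply ofLex.injective
  funext j
  change (if (j : ℕ) ≤ p then a j + c j else 0) =
    (if (j : ℕ) ≤ p then a j else 0) + (if (j : ℕ) ≤ p then c j else 0)
  split_ifs <;> rfl

theorem truncLex_mono_of_le {N p : ℕ} {a c : ℕ → ℕ} (h : ∀ i, a i ≤ c i) :
    truncLex N p a ≤ truncLex N p c := by
  apply Pi.toLex_monotone
  intro j
  change (if (j : ℕ) ≤ p then a j else 0) ≤ (if (j : ℕ) ≤ p then c j else 0)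
  split_ifs
  · exact h j
  · exact le_rfl

/-- The first position where `a` and `c` differ either survives the truncation and decides it, or
lies beyond `q`, and then the truncations coincide. -/
theorem truncate_lex_le {N : ℕ} (q : ℕ) {a c : Lex (Fin N → ℕ)} (h : a ≤ c) :
    (toLex fun j : Fin N => if (j : ℕ) ≤ q then ofLex a j else 0) ≤
      toLex fun j : Fin N => if (j : ℕ) ≤ q then ofLex c j else 0 := by
  rcases h.eq_or_lt with rfl | h
  · exact le_rfl
  obtain ⟨i, hi, hlt⟩ := h
  by_cases hq : (i : ℕ) ≤ q
  · apply le_of_lt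
    refine ⟨i, fun j hj => ?_, ?_⟩
    · change (if (j : ℕ) ≤ q then ofLex a j else 0) = (if (j : ℕ) ≤ q then ofLex c j else 0)
      rw [show ofLex a j = ofLex c j from hi j hj]
    · change (if (i : ℕ) ≤ q then ofLex a i else 0) < (if (i : ℕ) ≤ q then ofLex c i else 0)
      rw [if_pos hq, if_pos hq]
      exact hlt
  · apply le_of_eq
    congr 1
    funext j
    split_ifs with hj
    · exact hi j (by change (j : ℕ) < i; omega)
    · rfl

theorem truncLex_mono_right {N p q : ℕ} (hq : q ≤ p) {a c : ℕ → ℕ}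
    (h : truncLex N p a ≤ truncLex N p c) : truncLex N q a ≤ truncLex N q c := by
  have key : ∀ a : ℕ → ℕ, truncLex N q a =
      toLex fun j : Fin N => if (j : ℕ) ≤ q then ofLex (truncLex N p a) j else 0 := by
    intro a
    unfold truncLex
    congr 1
    funext j
    split_ifs with hj
    · change a j = if (j : ℕ) ≤ p then a j else 0
      rw [if_pos (hj.trans hq)]
    · rfl
  rw [key a, key c]
  exact truncate_lex_le q h

/-! ### Progress measures for either player -/

namespace Player

/-- The other player. -/
def opp : Player → Player
  | even => odd
  | odd => even

/-- The priorities that are good for a player. -/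
def Good : Player → ℕ → Prop
  | even, p => Even p
  | odd, p => ¬ Even p

theorem opp_opp (b : Player) : b.opp.opp = b := by cases b <;> rfl

theorem eq_opp_of_ne {a b : Player} (h : a ≠ b) : a = b.opp := by
  cases a <;> cases b <;> first | rfl | exact absurd rfl h

theorem exists_good (p : ℕ) : ∃ b : Player, b.Good p := by
  by_cases h : Even p
  · exact ⟨even, h⟩
  · exact ⟨odd, h⟩

end Player

/-- The comparison required of a progress measure of player `b` when moving from a vertex with
priority `p` and measure `a` to a vertex with measure `c`. -/
def ProgressStep (N : ℕ) (b : Player) (p : ℕ) (a c : ℕ → ℕ) : Prop :=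
  (b.Good p → truncLex N p c ≤ truncLex N p a) ∧
    (¬ b.Good p → truncLex N p c < truncLex N p a)

theorem ProgressStep.le {N : ℕ} {b : Player} {p : ℕ} {a c : ℕ → ℕ}
    (h : ProgressStep N b p a c) : truncLex N p c ≤ truncLex N p a := by
  by_cases hp : b.Good p
  · exact h.1 hp
  · exact (h.2 hp).le

/-- Adding a fixed tuple preserves lexicographic comparison, so a whole measure can be shifted. The
target is only required to be dominated by `d + c`, since it may carry a value from a different,
unshifted measure. -/
theorem ProgressStep.add_left {N : ℕ} {b : Player} {p : ℕ} {a c : ℕ → ℕ}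
    (h : ProgressStep N b p a c) (d : ℕ → ℕ) {c' : ℕ → ℕ} (hc : ∀ i, c' i ≤ d i + c i) :
    ProgressStep N b p (d + a) c' := by
  have hle : truncLex N p c' ≤ truncLex N p d + truncLex N p c := by
    rw [← truncLex_add]
    exact truncLex_mono_of_le hc
  unfold ProgressStep
  rw [truncLex_add]
  exact ⟨fun hp => hle.trans (add_le_add_right (h.1 hp) _),
    fun hp => hle.trans_lt (add_lt_add_right (h.2 hp) _)⟩

namespace ParityGame

variable {V : Type*}

/-- `ξ` is a progress measure of player `b` on `X` in the subgame on `S`, where moves from `X` may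
end in `T`, and the entries of `ξ` are bounded by the numbers of vertices in `X`. -/
structure IsProgressMeasure (G : ParityGame V) (N : ℕ) (b : Player) (S X T : Set V)
    (ξ : V → ℕ → ℕ) : Prop where
  le_count : ∀ x i, ξ x i ≤ {y | y ∈ X ∧ G.prio y = i}.ncard
  eq_zero : ∀ x, x ∉ X → ξ x = 0
  good : ∀ x i, b.Good i → ξ x i = 0
  pos : ∀ x ∈ X, ProgressStep N b (G.prio x) (ξ x) 0
  own : ∀ x ∈ X, G.owner x = b →
    ∃ y ∈ S, G.E x y ∧ y ∈ X ∪ T ∧ ProgressStep N b (G.prio x) (ξ x) (ξ y)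
  other : ∀ x ∈ X, G.owner x ≠ b → ∀ y ∈ S, G.E x y →
    y ∈ X ∪ T ∧ ProgressStep N b (G.prio x) (ξ x) (ξ y)

/-- There is a progress measure of player `b` on `X`, relative to the target `T`. -/
def HasMeasure (G : ParityGame V) (N : ℕ) (b : Player) (S X T : Set V) : Prop :=
  ∃ ξ, G.IsProgressMeasure N b S X T ξ

variable {G : ParityGame V} {N : ℕ} {b : Player} {S X T : Set V}

/-! ### Assembling progress measures, and determinacy -/

theorem HasMeasure.empty : G.HasMeasure N b S ∅ T :=
  ⟨fun _ _ => 0, fun _ _ => Nat.zero_le _, fun _ _ => rfl, fun _ _ _ => rfl,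
    fun _ hx => hx.elim, fun _ hx => hx.elim, fun _ hx => hx.elim⟩

/-- One step of attraction towards `T`. The measure vanishes on `T`, so a single unit at the
priority of `x`, needed only if that priority is bad, makes every move into `T` a progress step. -/
theorem HasMeasure.singleton {x : V} (hN : G.prio x < N) (hx : x ∉ T)
    (hown : G.owner x = b → ∃ y ∈ S, G.E x y ∧ y ∈ T)
    (hother : G.owner x ≠ b → ∀ y ∈ S, G.E x y → y ∈ T) : G.HasMeasure N b S {x} T := by
  classical
  let ξ : V → ℕ → ℕ := fun y i =>
    if y = x ∧ i = G.prio x ∧ ¬ b.Good i then 1 else 0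
  have hzero : ∀ y, y ≠ x → ξ y = 0 := fun y hy => by
    funext i
    exact if_neg fun h => hy h.1
  have hpos : ProgressStep N b (G.prio x) (ξ x) 0 := by
    refine ⟨fun _ => truncLex_mono_of_le fun i => Nat.zero_le _, fun hp => ?_⟩
    apply lt_of_le_of_ne (truncLex_mono_of_le fun i => Nat.zero_le _)
    intro h
    have := congrFun (congrArg ofLex h) ⟨G.prio x, hN⟩
    simp [truncLex, ξ, hp] at this
  refine ⟨ξ, ?_, fun y hy => hzero y hy, fun y i hi => if_neg fun h => h.2.2 hi, ?_, ?_, ?_⟩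
  · intro y i
    by_cases h : y = x ∧ i = G.prio x ∧ ¬ b.Good i
    · have h1 : {z | z ∈ ({x} : Set V) ∧ G.prio z = i} = {x} := by
        ext z
        simp only [Set.mem_ofPred_eq, Set.mem_singleton_iff]
        exact ⟨fun hz => hz.1, fun hz => ⟨hz, by rw [hz, h.2.1]⟩⟩
      rw [h1, Set.ncard_singleton]
      exact (if_pos h).le
    · exact (if_neg h).le.trans (Nat.zero_le _)
  · rintro y rfl
    exact hpos
  · rintro y rfl ho
    obtain ⟨z, hzS, hz, hzT⟩ := hown ho
    refine ⟨z, hzS, hz, Or.inr hzT, ?_⟩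
    rw [hzero z (fun h => hx (h ▸ hzT))]
    exact hpos
  · rintro y rfl ho z hzS hz
    have hzT := hother ho z hzS hz
    refine ⟨Or.inr hzT, ?_⟩
    rw [hzero z (fun h => hx (h ▸ hzT))]
    exact hpos

/-- The measure on `Y` is raised above all values taken on `T`, which makes moves from `Y` into `T`
progress. The counting bound survives because `Y` and `T` are disjoint. -/
theorem HasMeasure.union [Finite V] {Y Z : Set V} (hT : G.HasMeasure N b S T Z)
    (hY : G.HasMeasure N b S Y (T ∪ Z)) (hYT : Disjoint Y T) (hYZ : Disjoint Y Z) :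
    G.HasMeasure N b S (Y ∪ T) Z := by
  classical
  obtain ⟨ξT, hT⟩ := hT
  obtain ⟨ξY, hY⟩ := hY
  -- The largest tuple the counting bound allows on `T`, with zeros at the good positions so that
  -- the shifted measure still vanishes there.
  let d : ℕ → ℕ := fun i => if b.Good i then 0 else {y | y ∈ T ∧ G.prio y = i}.ncard
  let ξ : V → ℕ → ℕ := fun x => if x ∈ Y then d + ξY x else ξT x
  have hξY : ∀ x ∈ Y, ξ x = d + ξY x := fun x hx => if_pos hx
  have hξT : ∀ x, x ∉ Y → ξ x = ξT x := fun x hx => if_neg hx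
  have hle : ∀ x i, ξT x i ≤ d i := fun x i => by
    by_cases hi : b.Good i
    · rw [hT.good x i hi]
      exact Nat.zero_le _
    · exact (hT.le_count x i).trans (if_neg hi).ge
  have hd : ∀ i, d i ≤ {y | y ∈ T ∧ G.prio y = i}.ncard := fun i => by
    change (if _ then _ else _) ≤ _
    split_ifs
    · exact Nat.zero_le _
    · exact le_rfl
  have hcount : ∀ i, {y | y ∈ Y ∪ T ∧ G.prio y = i}.ncard =
      {y | y ∈ T ∧ G.prio y = i}.ncard + {y | y ∈ Y ∧ G.prio y = i}.ncard := fun i => by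
    rw [← Set.ncard_union_eq]
    · congr 1
      ext y
      simp only [Set.mem_ofPred_eq, Set.mem_union]
      tauto
    · rw [Set.disjoint_left]
      exact fun y hy hy' => Set.disjoint_left.mp hYT hy'.1 hy.1
  have hξle : ∀ y i, ξ y i ≤ d i + ξY y i := fun y i => by
    by_cases hy : y ∈ Y
    · rw [hξY y hy]
      exact le_rfl
    · rw [hξT y hy]
      exact (hle y i).trans (Nat.le_add_right _ _)
  -- The moves from `T` required by its measure never enter `Y`, so the shift does not affect them.
  have hnot : ∀ y, y ∈ T ∪ Z → y ∉ Y := fun y hy hy' =>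
    hy.elim (Set.disjoint_left.mp hYT hy') (Set.disjoint_left.mp hYZ hy')
  refine ⟨ξ, ?_, ?_, ?_, ?_, ?_, ?_⟩
  · intro x i
    rw [hcount]
    exact (hξle x i).trans (Nat.add_le_add (hd i) (hY.le_count x i))
  · intro x hx
    rw [hξT x fun h => hx (Or.inl h), hT.eq_zero x fun h => hx (Or.inr h)]
  · intro x i hi
    have h1 := hξle x i
    rw [hY.good x i hi, show d i = 0 from if_pos hi] at h1
    exact Nat.le_zero.mp h1
  · intro x hx
    by_cases hxY : x ∈ Y
    · rw [hξY x hxY]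
      exact (hY.pos x hxY).add_left d fun i => Nat.zero_le _
    · rw [hξT x hxY]
      exact hT.pos x (hx.resolve_left hxY)
  · intro x hx ho
    by_cases hxY : x ∈ Y
    · obtain ⟨y, hyS, hxy, hy, hp⟩ := hY.own x hxY ho
      refine ⟨y, hyS, hxy, ?_, ?_⟩
      · rw [Set.union_assoc]
        exact hy
      · rw [hξY x hxY]
        exact hp.add_left d (hξle y)
    · obtain ⟨y, hyS, hxy, hy, hp⟩ := hT.own x (hx.resolve_left hxY) ho
      refine ⟨y, hyS, hxy, ?_, ?_⟩
      · rw [Set.union_assoc]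
        exact Or.inr hy
      · rw [hξT x hxY, hξT y (hnot y hy)]
        exact hp
  · intro x hx ho y hyS hxy
    by_cases hxY : x ∈ Y
    · obtain ⟨hy, hp⟩ := hY.other x hxY ho y hyS hxy
      refine ⟨?_, ?_⟩
      · rw [Set.union_assoc]
        exact hy
      · rw [hξY x hxY]
        exact hp.add_left d (hξle y)
    · obtain ⟨hy, hp⟩ := hT.other x (hx.resolve_left hxY) ho y hyS hxy
      refine ⟨?_, ?_⟩
      · rw [Set.union_assoc]
        exact Or.inr hy
      · rw [hξT x hxY, hξT y (hnot y hy)]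
        exact hp

/-- Vertices outside of a subgame become a target. -/
theorem HasMeasure.of_diff (hX : X ⊆ S \ T) (h : G.HasMeasure N b (S \ T) X ∅) :
    G.HasMeasure N b S X T := by
  obtain ⟨ξ, h⟩ := h
  refine ⟨ξ, h.le_count, h.eq_zero, h.good, h.pos, ?_, ?_⟩
  · intro x hx ho
    obtain ⟨y, hyS, hxy, hy, hp⟩ := h.own x hx ho
    exact ⟨y, hyS.1, hxy, Or.inl (hy.resolve_right fun h => h), hp⟩
  · intro x hx ho y hyS hxy
    -- A move into `T` is compared with `0`, as `ξ` vanishes outside `X`.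
    by_cases hyT : y ∈ T
    · rw [h.eq_zero y fun hy => (hX hy).2 hyT]
      exact ⟨Or.inr hyT, h.pos x hx⟩
    · obtain ⟨hy, hp⟩ := h.other x hx ho y ⟨hyS, hyT⟩ hxy
      exact ⟨Or.inl (hy.resolve_right fun h => h), hp⟩

/-- A measure on a subgame that the opponent cannot leave is a measure on the whole game. -/
theorem HasMeasure.of_trap {S' : Set V} (hS' : S' ⊆ S) (hX : X ⊆ S')
    (htrap : ∀ x ∈ S', G.owner x ≠ b → ∀ y ∈ S, G.E x y → y ∈ S')
    (h : G.HasMeasure N b S' X T) : G.HasMeasure N b S X T := by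
  obtain ⟨ξ, h⟩ := h
  refine ⟨ξ, h.le_count, h.eq_zero, h.good, h.pos, ?_, ?_⟩
  · intro x hx ho
    obtain ⟨y, hyS, hxy, hy⟩ := h.own x hx ho
    exact ⟨y, hS' hyS, hxy, hy⟩
  · intro x hx ho y hyS hxy
    exact h.other x hx ho y (htrap x (hX hx) ho y hyS hxy) hxy

/-- A maximal set with a measure relative to `T` is closed under attraction. -/
theorem not_attracted_of_maximal [Finite V] (hN : ∀ x, G.prio x < N) {Y : Set V}
    (hY : Maximal (fun Y => Y ⊆ S \ T ∧ G.HasMeasure N b S Y T) Y) {x : V}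
    (hx : x ∈ S \ (Y ∪ T)) :
    (G.owner x = b → ∀ y ∈ S, G.E x y → y ∉ Y ∪ T) ∧
      (G.owner x ≠ b → ∃ y ∈ S, G.E x y ∧ y ∉ Y ∪ T) := by
  by_contra hcon
  -- An attracted vertex could be added to `Y` with a one-point measure, against maximality.
  have hm : G.HasMeasure N b S {x} (Y ∪ T) := by
    apply HasMeasure.singleton (hN x) hx.2
    · intro ho
      by_contra hno
      exact hcon ⟨fun _ y hyS hxy hy => hno ⟨y, hyS, hxy, hy⟩, fun h => absurd ho h⟩
    · intro ho y hyS hxy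
      by_contra hno
      exact hcon ⟨fun h => absurd h ho, fun _ => ⟨y, hyS, hxy, hno⟩⟩
  have hu := hY.prop.2.union hm
    (Set.disjoint_singleton_left.mpr fun h => hx.2 (Or.inl h))
    (Set.disjoint_singleton_left.mpr fun h => hx.2 (Or.inr h))
  have hsub : {x} ∪ Y ⊆ S \ T := Set.union_subset
    (Set.singleton_subset_iff.mpr ⟨hx.1, fun h => hx.2 (Or.inr h)⟩) hY.prop.1
  exact hx.2 (Or.inl (hY.le_of_ge ⟨hsub, hu⟩ Set.subset_union_right (Or.inl rfl)))

/-- Removing a set closed under attraction leaves no dead ends, so the recursion applies to the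
remainder. -/
theorem exists_succ_of_maximal [Finite V] (hN : ∀ x, G.prio x < N) {Y : Set V}
    (hS : ∀ x ∈ S, ∃ y ∈ S, G.E x y)
    (hY : Maximal (fun Y => Y ⊆ S \ T ∧ G.HasMeasure N b S Y T) Y) :
    ∀ x ∈ S \ (Y ∪ T), ∃ y ∈ S \ (Y ∪ T), G.E x y := by
  intro x hx
  obtain ⟨h1, h2⟩ := not_attracted_of_maximal hN hY hx
  by_cases ho : G.owner x = b
  · obtain ⟨y, hyS, hxy⟩ := hS x hx.1
    exact ⟨y, ⟨hyS, h1 ho y hyS hxy⟩, hxy⟩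
  · obtain ⟨y, hyS, hxy, hy⟩ := h2 ho
    exact ⟨y, ⟨hyS, hy⟩, hxy⟩

/-- If the vertices of the least priority `p` are good for `b`, then a measure on the other
vertices relative to them is a measure on all vertices. -/
theorem HasMeasure.of_least_good [Finite V] {p : ℕ} (hp : b.Good p)
    (hle : ∀ x ∈ S, p ≤ G.prio x) (hS : ∀ x ∈ S, ∃ y ∈ S, G.E x y)
    (h : G.HasMeasure N b S (S \ {x | G.prio x = p}) {x | G.prio x = p}) :
    G.HasMeasure N b S S ∅ := by
  obtain ⟨ξ, h⟩ := h
  -- No vertex of `S` has priority below `p`, and position `p` is good. So all truncations at `p`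
  -- vanish, and every move from a vertex of priority `p` is a progress step.
  have hz : ∀ x i, i ≤ p → ξ x i = 0 := by
    intro x i hi
    rcases hi.eq_or_lt with rfl | hi
    · exact h.good x _ hp
    · apply Nat.le_zero.mp
      refine (h.le_count x i).trans (le_of_eq ?_)
      rw [Set.ncard_eq_zero]
      ext y
      simp only [Set.mem_ofPred_eq, Set.mem_empty_iff_false, iff_false]
      rintro ⟨hy, rfl⟩
      exact absurd (hle y hy.1) (by omega)
  have htr : ∀ x, truncLex N p (ξ x) = truncLex N p 0 := by
    intro x
    unfold truncLex
    congr 1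
    funext j
    split_ifs with hj
    · exact hz x j hj
    · rfl
  have hstep : ∀ x y, G.prio x = p → ProgressStep N b (G.prio x) (ξ x) (ξ y) := by
    rintro x y rfl
    exact ⟨fun _ => by rw [htr, htr], fun hn => absurd hp hn⟩
  refine ⟨ξ, ?_, ?_, h.good, ?_, ?_, ?_⟩
  · intro x i
    refine (h.le_count x i).trans (Set.ncard_le_ncard ?_)
    exact fun y hy => ⟨hy.1.1, hy.2⟩
  · exact fun x hx => h.eq_zero x fun hx' => hx hx'.1
  · intro x hx
    by_cases hxp : G.prio x = p
    · exact ⟨fun _ => truncLex_mono_of_le fun i => Nat.zero_le _,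
        fun hn => absurd (hxp ▸ hp) hn⟩
    · exact h.pos x ⟨hx, hxp⟩
  · intro x hx ho
    by_cases hxp : G.prio x = p
    · obtain ⟨y, hyS, hxy⟩ := hS x hx
      exact ⟨y, hyS, hxy, Or.inl hyS, hstep x y hxp⟩
    · obtain ⟨y, hyS, hxy, -, hs⟩ := h.own x ⟨hx, hxp⟩ ho
      exact ⟨y, hyS, hxy, Or.inl hyS, hs⟩
  · intro x hx ho y hyS hxy
    by_cases hxp : G.prio x = p
    · exact ⟨Or.inl hyS, hstep x y hxp⟩
    · exact ⟨Or.inl hyS, (h.other x ⟨hx, hxp⟩ ho y hyS hxy).2⟩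

/-- Determinacy of finite parity games, in terms of progress measures. -/
theorem exists_hasMeasure_cover [Finite V] (G : ParityGame V) {N : ℕ} (hN : ∀ x, G.prio x < N)
    (S : Set V) (hS : ∀ x ∈ S, ∃ y ∈ S, G.E x y) :
    ∃ W : Player → Set V, (∀ b, W b ∪ W b.opp = S) ∧ ∀ b, G.HasMeasure N b S (W b) ∅ := by
  suffices key : ∃ b : Player, ∃ X Y : Set V, X ∪ Y = S ∧ G.HasMeasure N b S X ∅ ∧
      G.HasMeasure N b.opp S Y ∅ by
    obtain ⟨b, X, Y, hXY, hX, hY⟩ := key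
    cases b
    · refine ⟨fun c => match c with | Player.even => X | Player.odd => Y, ?_, ?_⟩
      · rintro (_ | _)
        · exact hXY
        · exact (Set.union_comm _ _).trans hXY
      · rintro (_ | _)
        · exact hX
        · exact hY
    · refine ⟨fun c => match c with | Player.even => Y | Player.odd => X, ?_, ?_⟩
      · rintro (_ | _)
        · exact (Set.union_comm _ _).trans hXY
        · exact hXY
      · rintro (_ | _)
        · exact hY
        · exact hX
  induction hn : S.ncard using Nat.strong_induction_on generalizing S with
  | _ n ih =>
  subst hn
  rcases S.eq_empty_or_nonempty with rfl | hne
  · exact ⟨Player.even, ∅, ∅, Set.union_self _, HasMeasure.empty, HasMeasure.empty⟩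
  obtain ⟨x₀, hx₀, hmin⟩ := Set.exists_min_image S G.prio (Set.toFinite S) hne
  obtain ⟨b, hb⟩ := Player.exists_good (G.prio x₀)
  -- The recursion covers each smaller subgame, for the fixed player `b`.
  have ih' : ∀ S' ⊂ S, (∀ x ∈ S', ∃ y ∈ S', G.E x y) → ∃ X Y : Set V, X ∪ Y = S' ∧
      G.HasMeasure N b S' X ∅ ∧ G.HasMeasure N b.opp S' Y ∅ := by
    intro S' hS' ht
    obtain ⟨c, X, Y, hXY, hX, hY⟩ := ih _ (Set.ncard_lt_ncard hS') S' ht rfl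
    by_cases hc : b = c
    · subst hc
      exact ⟨X, Y, hXY, hX, hY⟩
    · obtain rfl := Player.eq_opp_of_ne hc
      exact ⟨Y, X, (Set.union_comm _ _).trans hXY, hY, by rwa [Player.opp_opp]⟩
  set M : Set V := {x | G.prio x = G.prio x₀} with hM
  -- A maximal set with a measure relative to `M` plays the role of the attractor to `M` in
  -- Zielonka's recursion.
  obtain ⟨Y, -, hY⟩ := Set.Finite.exists_le_maximal (Set.toFinite
    {Y : Set V | Y ⊆ S \ M ∧ G.HasMeasure N b S Y M}) (a := ∅)
    ⟨Set.empty_subset _, HasMeasure.empty⟩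
  have hss : S \ (Y ∪ M) ⊂ S :=
    Set.sdiff_ssubset_left_iff.mpr ⟨x₀, hx₀, Or.inr rfl⟩
  obtain ⟨X', Y', hXY', hX', hY'⟩ := ih' _ hss (exists_succ_of_maximal hN hS hY)
  rcases Y'.eq_empty_or_nonempty with rfl | hne'
  · rw [Set.union_empty] at hXY'
    subst hXY'
    have h1 := hY.prop.2.union (HasMeasure.of_diff Set.Subset.rfl hX')
      (Set.disjoint_left.mpr fun x hx hxY => hx.2 (Or.inl hxY))
      (Set.disjoint_left.mpr fun x hx hxM => hx.2 (Or.inr hxM))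
    have h2 : S \ (Y ∪ M) ∪ Y = S \ M := by
      ext x
      have := @hY.prop.1 x
      simp only [Set.mem_union, Set.mem_sdiff] at this ⊢
      tauto
    rw [h2] at h1
    exact ⟨b, S, ∅, Set.union_empty _, HasMeasure.of_least_good hb hmin hS h1,
      HasMeasure.empty⟩
  -- Player `b` cannot move from the subgame into `Y ∪ M`, so `Y'` belongs to the opponent in `S` as
  -- well. Enlarging it to a maximal `B` leaves a strictly smaller game `S \ B` from which the
  -- opponent cannot reach `B`.
  · have hY'S : Y' ⊆ S \ (Y ∪ M) := hXY' ▸ Set.subset_union_right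
    have h1 : G.HasMeasure N b.opp S Y' ∅ := by
      apply HasMeasure.of_trap Set.sdiff_subset hY'S _ hY'
      intro x hx ho y hyS hxy
      have ho' : G.owner x = b := by rw [Player.eq_opp_of_ne ho, Player.opp_opp]
      exact ⟨hyS, (not_attracted_of_maximal hN hY hx).1 ho' y hyS hxy⟩
    obtain ⟨B, hYB, hB⟩ := Set.Finite.exists_le_maximal (Set.toFinite
      {B : Set V | B ⊆ S \ ∅ ∧ G.HasMeasure N b.opp S B ∅}) (a := Y')
      ⟨fun x hx => ⟨(hY'S hx).1, fun h => h⟩, h1⟩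
    have hBS : B ⊆ S := fun x hx => (hB.prop.1 hx).1
    have hss' : S \ B ⊂ S := by
      obtain ⟨y, hy⟩ := hne'
      exact Set.sdiff_ssubset_left_iff.mpr ⟨y, (hY'S hy).1, hYB hy⟩
    have hsucc := exists_succ_of_maximal hN hS hB
    have hatt := fun x => not_attracted_of_maximal hN hB (x := x)
    rw [Set.union_empty] at hsucc hatt
    obtain ⟨X₂, Y₂, hXY₂, hX₂, hY₂⟩ := ih' _ hss' hsucc
    have hX₂S : X₂ ⊆ S \ B := hXY₂ ▸ Set.subset_union_left
    have hY₂S : Y₂ ⊆ S \ B := hXY₂ ▸ Set.subset_union_right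
    refine ⟨b, X₂, Y₂ ∪ B, ?_, ?_, ?_⟩
    · rw [← Set.union_assoc, hXY₂]
      exact Set.sdiff_union_of_subset hBS
    · apply HasMeasure.of_trap Set.sdiff_subset hX₂S _ hX₂
      intro x hx ho y hyS hxy
      exact ⟨hyS, (hatt x hx).1 (Player.eq_opp_of_ne ho) y hyS hxy⟩
    · apply hB.prop.2.union
      · rw [Set.union_empty]
        exact HasMeasure.of_diff hY₂S hY₂
      · exact Set.disjoint_left.mpr fun x hx hxB => (hY₂S hx).2 hxB
      · exact Set.disjoint_empty _

end ParityGame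

namespace ParityGame

variable {V : Type*}

/-! ### Progress measures and the winner of a play -/

/-- There are finitely many priorities, so some priority recurs and the infimum is attained rather
than being the default `0` of an empty set. -/
theorem frequently_leastInfPrio {G : ParityGame V} {N : ℕ} (hN : ∀ x, G.prio x < N) (π : ℕ → V) :
    ∃ᶠ n in Filter.atTop, G.prio (π n) = G.leastInfPrio π := by
  apply Nat.sInf_mem (s := {p | ∃ᶠ n in Filter.atTop, G.prio (π n) = p})
  by_contra hempty
  have h : ∀ p ∈ Finset.range N, ∀ᶠ n in Filter.atTop, G.prio (π n) ≠ p := by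
    intro p _
    by_contra hp
    exact hempty ⟨p, hp⟩
  obtain ⟨n, hn⟩ := ((Filter.eventually_all_finset _).mpr h).exists
  exact hn _ (Finset.mem_range.mpr (hN _)) rfl

theorem eventually_leastInfPrio_le (G : ParityGame V) (π : ℕ → V) :
    ∀ᶠ n in Filter.atTop, G.leastInfPrio π ≤ G.prio (π n) := by
  have h : ∀ p ∈ Finset.range (G.leastInfPrio π), ∀ᶠ n in Filter.atTop, G.prio (π n) ≠ p := by
    intro p hp
    by_contra hcon
    exact absurd (Nat.sInf_le (s := {p | ∃ᶠ n in Filter.atTop, G.prio (π n) = p}) hcon)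
      (not_le.mpr (Finset.mem_range.mp hp))
  filter_upwards [(Filter.eventually_all_finset _).mpr h] with n hn
  by_contra hlt
  exact hn _ (Finset.mem_range.mpr (not_le.mp hlt)) rfl

/-- A play that eventually follows a progress measure is good for the player. -/
theorem good_leastInfPrio {G : ParityGame V} {N : ℕ} (hN : ∀ x, G.prio x < N) {b : Player}
    {ξ : V → ℕ → ℕ} {π : ℕ → V}
    (h : ∀ᶠ n in Filter.atTop,
      ProgressStep N b (G.prio (π n)) (ξ (π n)) (ξ (π (n + 1)))) :
    b.Good (G.leastInfPrio π) := by
  by_contra hbad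
  obtain ⟨n₀, hn₀⟩ := Filter.eventually_atTop.mp (h.and (G.eventually_leastInfPrio_le π))
  -- Truncated at the least recurring priority, the measures eventually never increase. If that
  -- priority were bad they would drop infinitely often, contradicting well-foundedness.
  let f : ℕ → Lex (Fin N → ℕ) := fun n => truncLex N (G.leastInfPrio π) (ξ (π n))
  have hstep : ∀ n ≥ n₀, f (n + 1) ≤ f n := fun n hn =>
    truncLex_mono_right (hn₀ n hn).2 (hn₀ n hn).1.le
  have hanti : ∀ m ≥ n₀, ∀ n ≥ m, f n ≤ f m := by
    intro m hm n hn
    induction n, hn using Nat.le_induction with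
    | base => exact le_rfl
    | succ n hn ih => exact (hstep n (hm.trans hn)).trans ih
  obtain ⟨_, ⟨m, hm, rfl⟩, hmin⟩ := (wellFounded_lt (α := Lex (Fin N → ℕ))).has_min
    (f '' Set.Ici n₀) ⟨_, n₀, Set.mem_Ici.mpr le_rfl, rfl⟩
  obtain ⟨n, hn, hp⟩ := (Filter.frequently_atTop.mp (frequently_leastInfPrio hN π)) m
  have hn' : n₀ ≤ n := le_trans hm hn
  have hlt : f (n + 1) < f n := by
    have := (hn₀ n hn').1.2 (by rwa [hp])
    rwa [hp] at this
  exact hmin _ ⟨n + 1, Set.mem_Ici.mpr (by omega), rfl⟩ (hlt.trans_le (hanti m hm n hn))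

/-! ### The game with sinks -/

/-- The game in which `v` and all vertices of priority `< k` become sinks; the latter get
priority `0`. -/
def sinkGame (G : ParityGame V) (k : ℕ) (v : V) : ParityGame V where
  E x y := ((x = v ∨ G.prio x < k) ∧ y = x) ∨ (¬ (x = v ∨ G.prio x < k) ∧ G.E x y)
  total x := by
    by_cases h : x = v ∨ G.prio x < k
    · exact ⟨x, Or.inl ⟨h, rfl⟩⟩
    · obtain ⟨y, hy⟩ := G.total x
      exact ⟨y, Or.inr ⟨h, hy⟩⟩
  prio x := if G.prio x < k then 0 else G.prio x
  owner := G.owner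

section Sinks

variable {G : ParityGame V} {k : ℕ} {v : V}

theorem sinkGame_edge {x y : V} (hx : x ≠ v) (hk : k ≤ G.prio x) :
    (G.sinkGame k v).E x y ↔ G.E x y := by
  have h : ¬ (x = v ∨ G.prio x < k) := by
    rintro (h | h)
    · exact hx h
    · omega
  exact ⟨fun hxy => hxy.elim (fun hn => absurd hn.1 h) (fun hn => hn.2), fun hxy => Or.inr ⟨h, hxy⟩⟩

theorem sinkGame_edge_sink {x y : V} (hx : x = v ∨ G.prio x < k) :
    (G.sinkGame k v).E x y ↔ y = x :=
  ⟨fun hxy => hxy.elim (fun h => h.2) (fun h => absurd hx h.1), fun h => Or.inl ⟨hx, h⟩⟩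

theorem sinkGame_prio {x : V} (hk : k ≤ G.prio x) : (G.sinkGame k v).prio x = G.prio x :=
  if_neg (not_lt.mpr hk)

theorem sinkGame_prio_low {x : V} (hk : G.prio x < k) : (G.sinkGame k v).prio x = 0 :=
  if_pos hk

variable {N : ℕ} {b : Player} {X : Set V} {ξ : V → ℕ → ℕ}

/-- A sink whose priority is bad for a player carries no progress measure of that player. -/
theorem IsProgressMeasure.sink_notMem
    (h : (G.sinkGame k v).IsProgressMeasure N b Set.univ X ∅ ξ) {x : V}
    (hx : x = v ∨ G.prio x < k) (hb : ¬ b.Good ((G.sinkGame k v).prio x)) : x ∉ X := by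
  intro hxX
  by_cases ho : G.owner x = b
  · obtain ⟨y, -, hxy, -, hp⟩ := h.own x hxX ho
    rw [(sinkGame_edge_sink hx).mp hxy] at hp
    exact lt_irrefl _ (hp.2 hb)
  · exact lt_irrefl _ ((h.other x hxX ho x trivial ((sinkGame_edge_sink hx).mpr rfl)).2.2 hb)

/-- The guarded attractor of `v` avoids the vertices where player `even` has a measure. -/
theorem guardedAttr_subset (hv : v ∉ X)
    (h : (G.sinkGame k v).IsProgressMeasure N Player.even Set.univ X ∅ ξ) :
    G.guardedAttr k {v} ⊆ Xᶜ := by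
  intro w hw
  induction hw with
  | base w hw _ =>
    rw [Set.mem_singleton_iff.mp hw]
    exact hv
  | odd w x hk ho hwx _ ih =>
    -- The vertex `v` has lost its edges in the game with sinks and must be treated apart; the guard
    -- `k ≤ G.prio w` excludes the other sinks.
    by_cases hwv : w = v
    · rw [hwv]
      exact hv
    · intro hwX
      have ho' : (G.sinkGame k v).owner w ≠ Player.even := by
        change G.owner w ≠ Player.even
        rw [ho]
        exact Player.noConfusion
      exact ih ((h.other w hwX ho' x trivial ((sinkGame_edge hwv hk).mpr hwx)).1.resolve_right
        fun h => h)
  | even w hk ho _ ih =>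
    by_cases hwv : w = v
    · rw [hwv]
      exact hv
    · intro hwX
      obtain ⟨y, -, hwy, hy, -⟩ := h.own w hwX ho
      exact ih y ((sinkGame_edge hwv hk).mp hwy) (hy.resolve_right fun h => h)

end Sinks

/-! ### Liftings stay below progress measures -/

section Lifting

variable [Fintype V] {G : ParityGame V}

theorem prio_lt_dim (G : ParityGame V) (x : V) : G.prio x < G.dim :=
  Nat.lt_succ_of_le (Finset.le_sup (Finset.mem_univ x))

theorem trunc_mono (p : ℕ) {m m' : G.Meas} (h : m ≤ m') : trunc p m ≤ trunc p m' := by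
  cases m' using WithTop.recTopCoe with
  | top => exact le_top
  | coe c =>
    cases m using WithTop.recTopCoe with
    | top => exact absurd h (not_le.mpr (WithTop.coe_lt_top _))
    | coe a =>
      have hac : a ≤ c := WithTop.coe_le_coe.mp h
      exact WithTop.coe_le_coe.mpr (truncate_lex_le p hac)

/-- The measure with the given entries. -/
noncomputable def measOf (a : ℕ → ℕ) (ha : ∀ i, a i ≤ G.bound i) : G.Meas :=
  ((⟨toLex fun j => a j, fun j => ha j⟩ : G.Tuple) : G.Meas)

theorem trunc_measOf_le {p : ℕ} {a c : ℕ → ℕ} {ha : ∀ i, a i ≤ G.bound i}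
    {hc : ∀ i, c i ≤ G.bound i} (h : truncLex G.dim p a ≤ truncLex G.dim p c) :
    trunc p (measOf a ha) ≤ trunc p (measOf c hc) :=
  WithTop.coe_le_coe.mpr h

theorem trunc_measOf_lt {p : ℕ} {a c : ℕ → ℕ} {ha : ∀ i, a i ≤ G.bound i}
    {hc : ∀ i, c i ≤ G.bound i} (h : truncLex G.dim p a < truncLex G.dim p c) :
    trunc p (measOf a ha) < trunc p (measOf c hc) :=
  WithTop.coe_lt_coe.mpr h

theorem measOf_ne_top {a : ℕ → ℕ} {ha : ∀ i, a i ≤ G.bound i} : measOf a ha ≠ ⊤ :=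
  WithTop.coe_ne_top

theorem zeroTuple_le (m : G.Meas) : ((G.zeroTuple : G.Tuple) : G.Meas) ≤ m := by
  cases m using WithTop.recTopCoe with
  | top => exact le_top
  | coe a =>
    apply WithTop.coe_le_coe.mpr
    exact Pi.toLex_monotone fun _ => Nat.zero_le _

/-- The measure that is maximal up to position `p` and zero afterwards. -/
noncomputable def satMeas (G : ParityGame V) (p : ℕ) : G.Meas :=
  measOf (G := G) (fun i => if i ≤ p then G.bound i else 0) fun i => by
    split_ifs
    · exact le_rfl
    · exact Nat.zero_le _

theorem trunc_trunc (p : ℕ) (m : G.Meas) : trunc p (trunc p m) = trunc p m := by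
  cases m using WithTop.recTopCoe with
  | top => rfl
  | coe a =>
    apply congrArg WithTop.some
    apply Subtype.ext
    apply ofLex.injective
    funext j
    change (if (j : ℕ) ≤ p then (if (j : ℕ) ≤ p then ofLex a.1 j else 0) else 0) =
      if (j : ℕ) ≤ p then ofLex a.1 j else 0
    split_ifs <;> rfl

theorem trunc_le_satMeas {p : ℕ} {m : G.Meas} (hm : m ≠ ⊤) : trunc p m ≤ G.satMeas p := by
  obtain ⟨a, rfl⟩ := WithTop.ne_top_iff_exists.mp hm
  apply WithTop.coe_le_coe.mpr
  apply Pi.toLex_monotone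
  intro j
  change (if (j : ℕ) ≤ p then ofLex a.1 j else 0) ≤ if (j : ℕ) ≤ p then G.bound j else 0
  split_ifs
  · exact a.2 j
  · exact le_rfl

theorem prog_le {ρ : V → G.Meas} {x y : V} {m : G.Meas} (h : ProgCond ρ x y m) :
    prog ρ x y ≤ m :=
  (prog_isLeast ρ x y).2 h

/-- A finite progress value has zeros after the position of the priority. -/
theorem prog_le_satMeas {ρ : V → G.Meas} {x y : V} (h : prog ρ x y ≠ ⊤) :
    prog ρ x y ≤ G.satMeas (G.prio x) := by
  -- The condition reads only positions up to the priority, so the truncated value satisfies it too,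
  -- and minimality bounds the value by its own truncation.
  have hc : ProgCond ρ x y (trunc (G.prio x) (prog ρ x y)) := by
    have := (prog_isLeast ρ x y).1
    simp only [Set.mem_ofPred_eq, ProgCond, LeUpTo, LtUpTo, h, false_and, or_false] at this ⊢
    rw [trunc_trunc]
    split_ifs at this ⊢
    · exact this
    · exact Or.inl this
  exact (prog_le hc).trans (trunc_le_satMeas h)

/-- The extremum over the finitely many successors is attained, so a lifting can be studied along
one edge. For `◇` the bound will come from another successor, hence the minimality clause. -/
theorem lift_self (ρ : V → G.Meas) (x : V) :
    (G.owner x = Player.even ∧ ∃ y, G.E x y ∧ lift ρ x x = max (ρ x) (prog ρ x y) ∧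
        ∀ z, G.E x z → prog ρ x y ≤ prog ρ x z) ∨
      (G.owner x = Player.odd ∧ ∃ y, G.E x y ∧ lift ρ x x = max (ρ x) (prog ρ x y)) := by
  classical
  cases ho : G.owner x with
  | even =>
    obtain ⟨y, hy, h⟩ := Finset.exists_mem_eq_inf' (G.succs_nonempty x) (prog ρ x)
    refine Or.inl ⟨rfl, y, by simpa [succs] using hy, ?_, fun z hz => ?_⟩
    · simp only [lift, Function.update_self, ho, h]
    · rw [← h]
      exact Finset.inf'_le _ (by simpa [succs] using hz)
  | odd =>
    obtain ⟨y, hy, h⟩ := Finset.exists_mem_eq_sup' (G.succs_nonempty x) (prog ρ x)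
    refine Or.inr ⟨rfl, y, by simpa [succs] using hy, ?_⟩
    simp only [lift, Function.update_self, ho, h]

theorem lift_of_ne (ρ : V → G.Meas) {x y : V} (h : y ≠ x) : lift ρ x y = ρ y := by
  classical
  exact Function.update_of_ne h _ _

variable {k : ℕ} {v : V} {X : Set V} {ξ : V → ℕ → ℕ}

theorem sinkGame_prio_lt_dim (k : ℕ) (v x : V) : (G.sinkGame k v).prio x < G.dim := by
  change (if G.prio x < k then 0 else G.prio x) < G.dim
  split_ifs
  · exact Nat.succ_pos _
  · exact G.prio_lt_dim x

theorem sinkMeasure_eq_zero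
    (h : (G.sinkGame k v).IsProgressMeasure G.dim Player.even Set.univ X ∅ ξ) (x : V) {i : ℕ}
    (hi : i < k) : ξ x i = 0 := by
  rcases Nat.eq_zero_or_pos i with rfl | hpos
  · exact h.good x 0 Even.zero
  · apply Nat.le_zero.mp
    refine (h.le_count x i).trans (le_of_eq ?_)
    rw [Set.ncard_eq_zero]
    ext y
    simp only [Set.mem_ofPred_eq, Set.mem_empty_iff_false, iff_false]
    rintro ⟨-, hy⟩
    change (if G.prio y < k then 0 else G.prio y) = i at hy
    split_ifs at hy <;> omega

theorem sinkMeasure_le_bound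
    (h : (G.sinkGame k v).IsProgressMeasure G.dim Player.even Set.univ X ∅ ξ) (x : V) (i : ℕ) :
    ξ x i ≤ G.bound i := by
  rcases lt_or_ge i k with hi | hi
  · rw [sinkMeasure_eq_zero h x hi]
    exact Nat.zero_le _
  · by_cases he : Even i
    · rw [h.good x i he]
      exact Nat.zero_le _
    · refine (h.le_count x i).trans ?_
      rw [bound, if_neg he]
      refine Set.ncard_le_ncard ?_
      rintro y ⟨-, hy⟩
      change (if G.prio y < k then 0 else G.prio y) = i at hy
      split_ifs at hy with hlt
      · subst hy
        exact absurd Even.zero he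
      · exact hy

/-- The source of strictness: `v` is counted in `bound k` but does not lie in `X`. -/
theorem sinkMeasure_lt_bound (hk : ¬ Even k) (hv : G.prio v = k) (hvX : v ∉ X)
    (h : (G.sinkGame k v).IsProgressMeasure G.dim Player.even Set.univ X ∅ ξ) (x : V) :
    ξ x k < G.bound k := by
  refine (h.le_count x k).trans_lt ?_
  rw [bound, if_neg hk]
  refine Set.ncard_lt_ncard ?_
  refine ⟨?_, fun hsub => hvX (hsub hv).1⟩
  rintro y ⟨-, hy⟩
  change (if G.prio y < k then 0 else G.prio y) = k at hy
  split_ifs at hy with hlt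
  · subst hy
    exact absurd Even.zero hk
  · exact hy

/-- The entries of the upper bound for the measures occurring in a lifting sequence. -/
noncomputable def sinkBound (G : ParityGame V) (k : ℕ) (ξ : V → ℕ → ℕ) (x : V) (i : ℕ) : ℕ :=
  if G.prio x < k then (if i ≤ G.prio x then G.bound i else 0)
  else if i < k then G.bound i else ξ x i

theorem sinkBound_le
    (h : (G.sinkGame k v).IsProgressMeasure G.dim Player.even Set.univ X ∅ ξ) (x : V) (i : ℕ) :
    sinkBound G k ξ x i ≤ G.bound i := by
  unfold sinkBound
  split_ifs
  · exact le_rfl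
  · exact Nat.zero_le _
  · exact le_rfl
  · exact sinkMeasure_le_bound h x i

/-- At `x` the bound is the saturated prefix plus `ξ x`, so the given step is merely shifted. A low
`y` has a bound below the prefix alone, and then positivity of `ξ x` suffices. -/
theorem sinkBound_step
    (h : (G.sinkGame k v).IsProgressMeasure G.dim Player.even Set.univ X ∅ ξ) {x y : V}
    (hx : x ∈ X) (hxk : k ≤ G.prio x)
    (hs : ProgressStep G.dim Player.even (G.prio x) (ξ x) (ξ y)) :
    ProgressStep G.dim Player.even (G.prio x) (sinkBound G k ξ x) (sinkBound G k ξ y) := by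
  have hpos := h.pos x hx
  rw [sinkGame_prio hxk] at hpos
  have hxe : sinkBound G k ξ x = (fun i => if i < k then G.bound i else 0) + ξ x := by
    funext i
    simp only [sinkBound, not_lt.mpr hxk, if_false, Pi.add_apply]
    split_ifs with hi
    · rw [sinkMeasure_eq_zero h x hi]
      rfl
    · exact (Nat.zero_add _).symm
  rw [hxe]
  by_cases hyk : G.prio y < k
  · apply hpos.add_left
    intro i
    simp only [sinkBound, hyk, if_true, Pi.zero_apply, Nat.add_zero]
    split_ifs <;> first | exact le_rfl | exact Nat.zero_le _ | omega
  · apply hs.add_left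
    intro i
    simp only [sinkBound, hyk, if_false]
    split_ifs <;> omega

theorem progCond_of_step {ρ : V → G.Meas} {x y : V} {a c : ℕ → ℕ} {ha : ∀ i, a i ≤ G.bound i}
    {hc : ∀ i, c i ≤ G.bound i} (hy : ρ y ≤ measOf c hc)
    (hs : ProgressStep G.dim Player.even (G.prio x) a c) : ProgCond ρ x y (measOf a ha) := by
  unfold ProgCond
  split_ifs with he
  · exact (trunc_mono _ hy).trans (trunc_measOf_le (hs.1 he))
  · exact Or.inl ((trunc_mono _ hy).trans_lt (trunc_measOf_lt (hs.2 he)))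

/-- The measures in a lifting sequence without `⊤` are bounded on the region of player `even` in
the game with sinks. -/
theorem le_sinkBound (hvX : v ∉ X)
    (h : (G.sinkGame k v).IsProgressMeasure G.dim Player.even Set.univ X ∅ ξ)
    {ρ : V → G.Meas}
    (hρ : Relation.ReflTransGen LiftStep (fun _ => ((G.zeroTuple : G.Tuple) : G.Meas)) ρ)
    (htop : ∀ w, ρ w ≠ ⊤) :
    ∀ x ∈ X, ρ x ≤ measOf (sinkBound G k ξ x) (sinkBound_le h x) := by
  induction hρ with
  | refl => exact fun x _ => zeroTuple_le _
  | tail _ hstep ih =>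
    rename_i ρ₁ ρ₂ hr
    obtain ⟨x, hlt, rfl⟩ := hstep
    -- Liftings only increase measures, so `⊤` was absent earlier too.
    have ih' := ih fun w hw => htop w (top_le_iff.mp (hw ▸ hlt.le w))
    intro z hz
    by_cases hzx : z = x
    swap
    · rw [lift_of_ne _ hzx]
      exact ih' z hz
    subst hzx
    -- Nothing is known about the successors of a low vertex in `G`, but a finite progress value
    -- there is at most `satMeas` at its priority, which is exactly its `sinkBound`.
    by_cases hlow : G.prio z < k
    · have key : ∀ y, lift ρ₁ z z = max (ρ₁ z) (prog ρ₁ z y) → lift ρ₁ z z ≤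
          measOf (sinkBound G k ξ z) (sinkBound_le h z) := by
        intro y hy
        have hne : prog ρ₁ z y ≠ ⊤ := fun hy' => htop z (by rw [hy, hy', max_top_right])
        rw [hy]
        apply max_le (ih' z hz)
        have he : G.satMeas (G.prio z) =
            measOf (sinkBound G k ξ z) (sinkBound_le h z) := by
          unfold satMeas
          congr 1
          funext i
          exact (if_pos hlow).symm
        rw [← he]
        exact prog_le_satMeas hne
      rcases lift_self ρ₁ z with ⟨-, y, -, hy, -⟩ | ⟨-, y, -, hy⟩
      · exact key y hy
      · exact key y hy
    · have hzk : k ≤ G.prio z := not_lt.mp hlow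
      have hzv : z ≠ v := fun hzv => hvX (hzv ▸ hz)
      have key : ∀ y ∈ X, ProgressStep G.dim Player.even (G.prio z) (ξ z) (ξ y) →
          prog ρ₁ z y ≤ measOf (sinkBound G k ξ z) (sinkBound_le h z) := fun y hyX hs =>
        prog_le (progCond_of_step (ih' y hyX) (sinkBound_step h hz hzk hs))
      rcases lift_self ρ₁ z with ⟨ho, y, -, hy, hmin⟩ | ⟨ho, y, hzy, hy⟩
      · obtain ⟨u, -, hzu, hu, hs⟩ := h.own z hz ho
        rw [sinkGame_prio hzk] at hs
        rw [hy]
        exact max_le (ih' z hz) ((hmin u ((sinkGame_edge hzv hzk).mp hzu)).trans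
          (key u (hu.resolve_right fun h => h) hs))
      · have ho' : (G.sinkGame k v).owner z ≠ Player.even := by
          change G.owner z ≠ Player.even
          rw [ho]
          exact Player.noConfusion
        obtain ⟨hyX, hs⟩ := h.other z hz ho' y trivial ((sinkGame_edge hzv hzk).mpr hzy)
        rw [sinkGame_prio hzk] at hs
        rw [hy]
        exact max_le (ih' z hz) (key y (hyX.resolve_right fun h => h) hs)

/-- On the region of player `even` in the game with sinks, the measures stay strictly below
saturation up to position `k`. -/
theorem lt_satMeas (hk : ¬ Even k) (hv : G.prio v = k) (hvX : v ∉ X)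
    (h : (G.sinkGame k v).IsProgressMeasure G.dim Player.even Set.univ X ∅ ξ)
    {ρ : V → G.Meas}
    (hρ : Relation.ReflTransGen LiftStep (fun _ => ((G.zeroTuple : G.Tuple) : G.Meas)) ρ)
    (htop : ∀ w, ρ w ≠ ⊤) {x : V} (hx : x ∈ X) : LtUpTo k (ρ x) (G.satMeas k) := by
  refine (trunc_mono k (le_sinkBound hvX h hρ htop x hx)).trans_lt (trunc_measOf_lt ?_)
  have hkN : k < G.dim := hv ▸ G.prio_lt_dim v
  -- For a low `x` the entry at `k` is `0`, and `bound k` is positive by `hb`.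
  have hlt : sinkBound G k ξ x k < G.bound k := by
    have hb := sinkMeasure_lt_bound hk hv hvX h x
    unfold sinkBound
    split_ifs <;> omega
  have hle : ∀ j : Fin G.dim, (if (j : ℕ) ≤ k then sinkBound G k ξ x j else 0) ≤
      if (j : ℕ) ≤ k then (if (j : ℕ) ≤ k then G.bound j else 0) else 0 := by
    intro j
    split_ifs
    · exact sinkBound_le h x j
    · exact le_rfl
  refine lt_of_le_of_ne (Pi.toLex_monotone hle) fun heq => ?_
  have := congrFun (congrArg ofLex heq) ⟨k, hkN⟩
  simp [truncLex] at this
  omega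

theorem prog_ne_top_of_even {ρ : V → G.Meas} {x y : V} (he : Even (G.prio x)) (hy : ρ y ≠ ⊤) :
    prog ρ x y ≠ ⊤ := by
  have : prog ρ x y ≤ ρ y := prog_le (by
    unfold ProgCond
    rw [if_pos he]
    exact le_refl (trunc _ _))
  exact fun h => hy (top_le_iff.mp (h ▸ this))

/-- The saturated tuple is a finite candidate for the minimum. Used contrapositively: a progress
value `⊤` forces the successor to be saturated. -/
theorem prog_ne_top_of_lt {ρ : V → G.Meas} {x y : V} (ho : ¬ Even (G.prio x))
    (hy : LtUpTo (G.prio x) (ρ y) (G.satMeas (G.prio x))) : prog ρ x y ≠ ⊤ := by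
  have : prog ρ x y ≤ G.satMeas (G.prio x) := prog_le (by
    unfold ProgCond
    rw [if_neg ho]
    exact Or.inl hy)
  exact fun h => measOf_ne_top (top_le_iff.mp (h ▸ this))

end Lifting

end ParityGame

namespace ParityGame

variable {V : Type*} {G : ParityGame V}

/-! ### Positional strategies -/

namespace PosStrategy

variable {i : Player}

theorem consistent_iff (σ : G.PosStrategy i) (π : ℕ → V) :
    σ.toStrategy.Consistent π ↔
      ∀ n (h : G.owner (π n) = i), π (n + 1) = σ.move (π n) h := by
  classical
  have hlast : ∀ n, (playPrefix π n).getLast? = some (π n) := fun n => by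
    simp [playPrefix, List.range_succ]
  constructor
  · intro hc n h
    apply hc n
    simp [toStrategy, hlast, h]
  · intro hc n x hx
    by_cases h : G.owner (π n) = i
    · rw [hc n h]
      simpa [toStrategy, hlast, h] using hx
    · simp [toStrategy, hlast, h] at hx

theorem exists_play (σ : G.PosStrategy i) (x : V) :
    ∃ π : ℕ → V, G.IsPlay π ∧ π 0 = x ∧ σ.toStrategy.Consistent π := by
  classical
  choose s hs using G.total
  let f : V → V := fun y => if h : G.owner y = i then σ.move y h else s y
  have hf : ∀ y, G.E y (f y) := fun y => by
    by_cases h : G.owner y = i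
    · simp only [f, dif_pos h]
      exact σ.legal y h
    · simp only [f, dif_neg h]
      exact hs y
  refine ⟨fun n => f^[n] x, fun n => ?_, rfl, (σ.consistent_iff _).mpr fun n h => ?_⟩
  · simp only [Function.iterate_succ_apply']
    exact hf _
  · simp only [Function.iterate_succ_apply']
    exact dif_pos h

theorem exists_of_owner (G : ParityGame V) (i : Player) (P : ∀ w, G.owner w = i → V → Prop)
    (h : ∀ w (hw : G.owner w = i), ∃ x, G.E w x ∧ P w hw x) :
    ∃ σ : G.PosStrategy i, ∀ w hw, P w hw (σ.move w hw) := by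
  choose f hf hP using h
  exact ⟨⟨f, hf⟩, hP⟩

/-- A strategy whose moves stay in `D` is closed on `D`. -/
theorem closedOn_of_move (σ : G.PosStrategy i) {D : Set V}
    (hown : ∀ x ∈ D, ∀ h : G.owner x = i, σ.move x h ∈ D)
    (hother : ∀ x ∈ D, G.owner x ≠ i → ∀ y, G.E x y → y ∈ D) : σ.toStrategy.ClosedOn D := by
  intro π hπ h0 hc n
  rw [consistent_iff] at hc
  induction n with
  | zero => exact h0
  | succ n ih =>
    by_cases ho : G.owner (π n) = i
    · rw [hc n ho]
      exact hown _ ih ho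
    · exact hother _ ih ho _ (hπ n)

end PosStrategy

/-! ### Attraction -/

section Attraction

variable {k : ℕ} {v : V}

theorem guardedAttr_even_step {w x : V} (h : w ∈ G.guardedAttr k {v}) (hw : w ≠ v)
    (ho : G.owner w ≠ Player.odd) (hx : G.E w x) : x ∈ G.guardedAttr k {v} := by
  cases h with
  | base _ h _ => exact absurd h hw
  | odd _ _ _ ho' => exact absurd ho' ho
  | even _ _ _ h => exact h x hx

/-- Attraction speaks of plays only; running one from `w ≠ v` reaches `v` after at least one step,
so its first move is still inside `A`. -/
theorem IsAttracting.move_mem {τ : G.PosStrategy Player.odd} {A : Set V}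
    (h : G.IsAttracting τ A {v}) {w : V} (hw : w ∈ A) (hwv : w ≠ v)
    (ho : G.owner w = Player.odd) : τ.move w ho ∈ A := by
  obtain ⟨π, hπ, rfl, hc⟩ := τ.exists_play w
  obtain ⟨n, hn, hA⟩ := h π hπ hw hc
  rw [← (τ.consistent_iff π).mp hc 0 ho]
  apply hA
  by_contra h0
  exact hwv (by rwa [show n = 0 by omega] at hn)

/-- A play that follows an attracting strategy as long as it has not seen the target reaches it. -/
theorem IsAttracting.reaches {τ : G.PosStrategy Player.odd} {A : Set V}
    (h : G.IsAttracting τ A {v}) (hA : ∀ x ∈ A, x ≠ v → G.owner x ≠ Player.odd →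
      ∀ y, G.E x y → y ∈ A) {π : ℕ → V} (hπ : G.IsPlay π)
    (hc : ∀ n (ho : G.owner (π n) = Player.odd), π n ∈ A → π n ≠ v →
      π (n + 1) = τ.move (π n) ho) {m : ℕ} (hm : π m ∈ A) : ∃ n ≥ m, π n = v := by
  -- A tail that never meets `v` would remain in `A` and thus follow `τ` forever, contradicting
  -- attraction.
  by_contra! hno
  have hmem : ∀ n, π (m + n) ∈ A := by
    intro n
    induction n with
    | zero => exact hm
    | succ n ih =>
      have hne := hno (m + n) (Nat.le_add_right m n)
      by_cases ho : G.owner (π (m + n)) = Player.odd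
      · rw [← Nat.add_assoc, hc _ ho ih hne]
        exact h.move_mem ih hne ho
      · exact hA _ ih hne ho _ (hπ (m + n))
  obtain ⟨n, hn, -⟩ := h (fun n => π (m + n)) (fun n => hπ (m + n)) hm
    ((τ.consistent_iff _).mpr fun n ho => hc (m + n) ho (hmem n) (hno _ (Nat.le_add_right m n)))
  exact hno (m + n) (Nat.le_add_right m n) hn

/-- The stages of the guarded attractor. -/
def attrStage (G : ParityGame V) (k : ℕ) (v : V) : ℕ → Set V
  | 0 => {w | w = v ∧ k ≤ G.prio w}
  | n + 1 => attrStage G k v n ∪ {w | k ≤ G.prio w ∧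
      ((G.owner w = Player.odd ∧ ∃ x ∈ attrStage G k v n, G.E w x) ∨
        (G.owner w = Player.even ∧ ∀ x, G.E w x → x ∈ attrStage G k v n))}

theorem attrStage_mono : Monotone (G.attrStage k v) :=
  monotone_nat_of_le_succ fun _ => Set.subset_union_left

theorem attrStage_subset (n : ℕ) : G.attrStage k v n ⊆ G.guardedAttr k {v} := by
  induction n with
  | zero => exact fun w hw => GuardedAttr.base w hw.1 hw.2
  | succ n ih =>
    rintro w (hw | ⟨hk, ⟨ho, x, hx, hwx⟩ | ⟨ho, h⟩⟩)
    · exact ih hw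
    · exact GuardedAttr.odd w x hk ho hwx (ih hx)
    · exact GuardedAttr.even w hk ho fun x hx => ih (h x hx)

/-- For a `◇`-vertex a common stage of all successors is needed; it exists since `V` is finite. -/
theorem exists_attrStage [Finite V] {w : V} (h : w ∈ G.guardedAttr k {v}) :
    ∃ n, w ∈ G.attrStage k v n := by
  induction h with
  | base w hw hk => exact ⟨0, hw, hk⟩
  | odd w x hk ho hwx _ ih =>
    obtain ⟨n, hn⟩ := ih
    exact ⟨n + 1, Or.inr ⟨hk, Or.inl ⟨ho, x, hn, hwx⟩⟩⟩
  | even w hk ho _ ih =>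
    have hex : ∀ x, ∃ n, G.E w x → x ∈ G.attrStage k v n := fun x => by
      by_cases hx : G.E w x
      · obtain ⟨n, hn⟩ := ih x hx
        exact ⟨n, fun _ => hn⟩
      · exact ⟨0, fun h => absurd h hx⟩
    choose f hf using hex
    obtain ⟨n, hn⟩ := (Set.finite_range f).bddAbove
    exact ⟨n + 1, Or.inr ⟨hk, Or.inr ⟨ho, fun x hx => attrStage_mono (hn ⟨x, rfl⟩) (hf x hx)⟩⟩⟩

/-- The stage at which a vertex appears is a rank; `τ` lowers it at `□`-vertices, and every move
lowers it at `◇`-vertices. -/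
theorem exists_isAttracting [Finite V] (G : ParityGame V) (k : ℕ) (v : V) :
    ∃ τ : G.PosStrategy Player.odd, G.IsAttracting τ (G.guardedAttr k {v}) {v} := by
  classical
  -- The stages increase, so at most one `n` satisfies both premises and one successor serves for
  -- all `n`.
  obtain ⟨τ, hτ⟩ := PosStrategy.exists_of_owner G Player.odd
    (fun w _ x => ∀ n, w ∉ G.attrStage k v n → w ∈ G.attrStage k v (n + 1) →
      x ∈ G.attrStage k v n) (by
    intro w ho
    by_cases hw : ∃ n, w ∉ G.attrStage k v n ∧ w ∈ G.attrStage k v (n + 1)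
    · obtain ⟨n, hn, hn'⟩ := hw
      rcases hn' with hn' | ⟨-, ⟨-, x, hx, hwx⟩ | ⟨ho', -⟩⟩
      · exact absurd hn' hn
      · refine ⟨x, hwx, fun m hm hm' => ?_⟩
        have hnm : n ≤ m := by
          by_contra hlt
          exact hn (attrStage_mono (show m + 1 ≤ n by omega) hm')
        exact attrStage_mono hnm hx
      · rw [ho] at ho'
        exact Player.noConfusion ho'
    · obtain ⟨x, hx⟩ := G.total w
      exact ⟨x, hx, fun n h1 h2 => absurd ⟨n, h1, h2⟩ hw⟩)
  refine ⟨τ, fun π hπ h0 hc => ?_⟩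
  rw [τ.consistent_iff] at hc
  obtain ⟨n, hn⟩ := exists_attrStage h0
  clear h0
  induction n generalizing π with
  | zero => exact ⟨0, hn.1, fun m hm => by
      rw [Nat.le_zero.mp hm]
      exact attrStage_subset 0 hn⟩
  | succ n ih =>
    by_cases hn' : π 0 ∈ G.attrStage k v n
    · exact ih π hπ hc hn'
    have h1 : π 1 ∈ G.attrStage k v n := by
      by_cases ho : G.owner (π 0) = Player.odd
      · rw [hc 0 ho]
        exact hτ _ ho n hn' hn
      · rcases hn with hn | ⟨-, ⟨ho', -⟩ | ⟨-, h⟩⟩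
        · exact absurd hn hn'
        · exact absurd ho' ho
        · exact h _ (hπ 0)
    obtain ⟨m, hm, hA⟩ := ih (fun n => π (n + 1)) (fun n => hπ (n + 1)) (fun n => hc (n + 1)) h1
    refine ⟨m + 1, hm, fun j hj => ?_⟩
    cases j with
    | zero => exact attrStage_subset _ hn
    | succ j => exact hA j (by omega)

end Attraction

/-! ### The dominion -/

section Dominion

variable [Fintype V] {k : ℕ} {v : V} {W : Set V} {ξ : V → ℕ → ℕ}

/-- Combining the region of player `odd` in the game with sinks, an attracting strategy and a move
at `v` that stays in the region. -/
theorem exists_winning_strategy (hk : ¬ Even k) (hv : G.prio v = k)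
    (hξ : (G.sinkGame k v).IsProgressMeasure G.dim Player.odd Set.univ W ∅ ξ)
    (hAW : G.guardedAttr k {v} ⊆ W) (hWk : ∀ w ∈ W, k ≤ G.prio w)
    (hveven : G.owner v ≠ Player.odd → ∀ u, G.E v u → u ∈ W)
    {u : V} (hvu : G.E v u) (huW : u ∈ W)
    {τ : G.PosStrategy Player.odd} (hτ : G.IsAttracting τ (G.guardedAttr k {v}) {v}) :
    ∃ σ : G.PosStrategy Player.odd,
      σ.toStrategy.WinningOn W ∧ σ.toStrategy.ClosedOn W ∧
      (∀ hv : G.owner v = Player.odd, σ.move v hv = u) ∧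
      ∀ w (hw : G.owner w = Player.odd), w ∈ G.guardedAttr k {v} \ {v} →
        σ.move w hw = τ.move w hw := by
  classical
  -- Three regimes: `u` at `v`, `τ` on the rest of the attractor, and a measure-respecting move on
  -- the rest of `W`.
  obtain ⟨σ, hσ⟩ := PosStrategy.exists_of_owner G Player.odd
    (fun w ho x => (w = v → x = u) ∧ (w ≠ v → w ∈ G.guardedAttr k {v} → x = τ.move w ho) ∧
      (w ≠ v → w ∉ G.guardedAttr k {v} → w ∈ W → x ∈ W ∧
        ProgressStep G.dim Player.odd (G.prio w) (ξ w) (ξ x))) (by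
    intro w ho
    by_cases hwv : w = v
    · subst hwv
      exact ⟨u, hvu, fun _ => rfl, fun h => absurd rfl h, fun h => absurd rfl h⟩
    by_cases hwA : w ∈ G.guardedAttr k {v}
    · exact ⟨_, τ.legal w ho, fun h => absurd h hwv, fun _ _ => rfl, fun _ h => absurd hwA h⟩
    by_cases hwW : w ∈ W
    · obtain ⟨x, -, hx, hxW, hs⟩ := hξ.own w hwW ho
      rw [sinkGame_prio (hWk w hwW)] at hs
      exact ⟨x, (sinkGame_edge hwv (hWk w hwW)).mp hx, fun h => absurd h hwv,
        fun _ h => absurd h hwA, fun _ _ _ => ⟨hxW.resolve_right fun h => h, hs⟩⟩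
    · exact ⟨_, τ.legal w ho, fun h => absurd h hwv, fun _ _ => rfl, fun _ _ h => absurd h hwW⟩)
  have hother : ∀ x ∈ W, x ≠ v → G.owner x ≠ Player.odd → ∀ y, G.E x y → y ∈ W ∧
      ProgressStep G.dim Player.odd (G.prio x) (ξ x) (ξ y) := by
    intro x hx hxv ho y hxy
    obtain ⟨hy, hs⟩ := hξ.other x hx ho y trivial ((sinkGame_edge hxv (hWk x hx)).mpr hxy)
    rw [sinkGame_prio (hWk x hx)] at hs
    exact ⟨hy.resolve_right fun h => h, hs⟩
  have hclosed : σ.toStrategy.ClosedOn W := by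
    apply σ.closedOn_of_move
    · intro x hx ho
      by_cases hxv : x = v
      · rw [(hσ x ho).1 hxv]
        exact huW
      by_cases hxA : x ∈ G.guardedAttr k {v}
      · rw [(hσ x ho).2.1 hxv hxA]
        exact hAW (hτ.move_mem hxA hxv ho)
      · exact ((hσ x ho).2.2 hxv hxA hx).1
    · intro x hx ho y hxy
      by_cases hxv : x = v
      · subst hxv
        exact hveven ho y hxy
      · exact (hother x hx hxv ho y hxy).1
  refine ⟨σ, ?_, hclosed, fun ho => (hσ v ho).1 rfl, fun w ho hw => (hσ w ho).2.1 hw.2 hw.1⟩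
  intro π hπ h0 hc
  have hW := hclosed π hπ h0 hc
  rw [σ.consistent_iff] at hc
  change ¬ Even (G.leastInfPrio π)
  -- Recurring visits to `v` give least priority at most `k`, and `W` has no smaller priorities.
  -- Otherwise the play eventually avoids the attractor, since entering it would lead to `v` again.
  by_cases hfreq : ∃ᶠ n in Filter.atTop, π n = v
  · have hle : G.leastInfPrio π ≤ k := by
      refine Nat.sInf_le (s := {p | ∃ᶠ n in Filter.atTop, G.prio (π n) = p}) ?_
      exact hfreq.mono fun n hn => by rw [hn, hv]
    obtain ⟨n, hn⟩ := (frequently_leastInfPrio G.prio_lt_dim π).exists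
    have hge := hWk _ (hW n)
    rwa [show G.leastInfPrio π = k by omega]
  · apply good_leastInfPrio (b := Player.odd) G.prio_lt_dim (ξ := ξ)
    obtain ⟨n₀, hn₀⟩ := Filter.eventually_atTop.mp (Filter.not_frequently.mp hfreq)
    filter_upwards [Filter.eventually_ge_atTop n₀] with n hn
    have hnA : π n ∉ G.guardedAttr k {v} := by
      intro hnA
      obtain ⟨m, hm, hmv⟩ := hτ.reaches
        (fun x hx hxv ho y hxy => guardedAttr_even_step hx hxv ho hxy) hπ
        (fun n ho hA hne => (hc n ho).trans ((hσ _ ho).2.1 hne hA)) hnA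
      exact hn₀ m (hn.trans hm) hmv
    by_cases ho : G.owner (π n) = Player.odd
    · rw [hc n ho]
      exact ((hσ _ ho).2.2 (hn₀ n hn) hnA (hW n)).2
    · exact (hother _ (hW n) (hn₀ n hn) ho _ (hπ n)).2

/-- The region of player `odd` in the game with sinks, when a vertex is lifted to `⊤`. -/
theorem exists_odd_region (hk : ¬ Even k) (hv : G.prio v = k) {ρ : V → G.Meas}
    (hρ : Relation.ReflTransGen LiftStep (fun _ => ((G.zeroTuple : G.Tuple) : G.Meas)) ρ)
    (htop : ∀ w, ρ w ≠ ⊤) :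
    ∃ W : Set V, ∃ ξ, (G.sinkGame k v).IsProgressMeasure G.dim Player.odd Set.univ W ∅ ξ ∧
      G.guardedAttr k {v} ⊆ W ∧ (∀ w ∈ W, k ≤ G.prio w) ∧
      ∀ w, ¬ LtUpTo k (ρ w) (G.satMeas k) → w ∈ W := by
  obtain ⟨R, hcover, hR⟩ := exists_hasMeasure_cover (G.sinkGame k v)
    (sinkGame_prio_lt_dim k v) Set.univ
    (fun x _ => ((G.sinkGame k v).total x).imp fun y hy => ⟨trivial, hy⟩)
  obtain ⟨ξe, hξe⟩ := hR Player.even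
  obtain ⟨ξo, hξo⟩ := hR Player.odd
  have hsub : (R Player.even)ᶜ ⊆ R Player.odd := fun x hx =>
    ((hcover Player.even).ge (Set.mem_univ x)).resolve_left hx
  have hvX : v ∉ R Player.even := hξe.sink_notMem (Or.inl rfl) (by
    rw [sinkGame_prio hv.ge, hv]
    exact hk)
  refine ⟨R Player.odd, ξo, hξo, (guardedAttr_subset hvX hξe).trans hsub, fun w hw => ?_,
    fun w hw => hsub fun hwX => hw (lt_satMeas hk hv hvX hξe hρ htop hwX)⟩
  -- A vertex of priority `< k` is a sink of even priority, so it carries no measure of `□`.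
  by_contra hlow
  refine hξo.sink_notMem (Or.inr (not_le.mp hlow)) ?_ hw
  rw [sinkGame_prio_low (not_le.mp hlow)]
  exact fun h => h Even.zero

end Dominion

end ParityGame

/-! ### The first vertex lifted to `⊤` -/

theorem mainTheorem1 {V : Type*} [Fintype V] (G : ParityGame V)
    (ρ : V → G.Meas) (v : V) (k : ℕ) (hk : G.prio v = k)
    (hfirst : ParityGame.IsFirstTop ρ v) :
    -- there is a strategy attracting towards `v` in the guarded attractor
    (∃ τ : G.PosStrategy Player.odd, G.IsAttracting τ (G.guardedAttr k {v}) {v}) ∧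
    -- `v` is owned by player odd
    (∀ hv : G.owner v = Player.odd,
      ∀ u, G.E v u → (∀ u', G.E v u' → ρ u' ≤ ρ u) →
        ∃ D : Set V, G.IsDominion Player.odd D ∧ G.guardedAttr k {v} ⊆ D ∧
          (∀ w ∈ D, k ≤ G.prio w) ∧
          ∀ τ : G.PosStrategy Player.odd, G.IsAttracting τ (G.guardedAttr k {v}) {v} →
            ∃ σ : G.PosStrategy Player.odd,
              σ.toStrategy.WinningOn D ∧ σ.toStrategy.ClosedOn D ∧ σ.move v hv = u ∧
              ∀ w (hw : G.owner w = Player.odd), w ∈ G.guardedAttr k {v} \ {v} →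
                σ.move w hw = τ.move w hw) ∧
    -- `v` is owned by player even
    (G.owner v = Player.even →
        ∃ D : Set V, G.IsDominion Player.odd D ∧ G.guardedAttr k {v} ⊆ D ∧
          (∀ w ∈ D, k ≤ G.prio w) ∧
          (∀ u, G.E v u → u ∈ D) ∧
          ∀ τ : G.PosStrategy Player.odd, G.IsAttracting τ (G.guardedAttr k {v}) {v} →
            ∃ σ : G.PosStrategy Player.odd,
              σ.toStrategy.WinningOn D ∧ σ.toStrategy.ClosedOn D ∧
              ∀ w (hw : G.owner w = Player.odd), w ∈ G.guardedAttr k {v} \ {v} →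
                σ.move w hw = τ.move w hw) := by
  open ParityGame in
  obtain ⟨ρ₀, hρ₀, htop, rfl, hvtop⟩ := hfirst
  subst hk
  obtain ⟨τ₀, hτ₀⟩ := exists_isAttracting G (G.prio v) v
  have hmax : ∀ m, max (ρ₀ v) m = ⊤ → m = ⊤ := by
    intro m hm
    rcases max_choice (ρ₀ v) m with h | h
    · exact absurd (h.symm.trans hm) (htop v)
    · exact h.symm.trans hm
  have hodd : ¬ Even (G.prio v) := by
    intro he
    rcases lift_self ρ₀ v with ⟨-, y, -, hy, -⟩ | ⟨-, y, -, hy⟩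
    · exact prog_ne_top_of_even he (htop y) (hmax _ (hy.symm.trans hvtop))
    · exact prog_ne_top_of_even he (htop y) (hmax _ (hy.symm.trans hvtop))
  -- The region `W` serves as the dominion in both cases; it depends neither on `u` nor on `τ`.
  obtain ⟨W, ξ, hξ, hAW, hWk, hsat⟩ := exists_odd_region hodd rfl hρ₀ htop
  have hvW : v ∈ W := hAW (GuardedAttr.base v rfl le_rfl)
  have hprog : ∀ y, prog ρ₀ v y = ⊤ → ¬ LtUpTo (G.prio v) (ρ₀ y) (G.satMeas (G.prio v)) :=
    fun y hy hlt => prog_ne_top_of_lt hodd hlt hy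
  refine ⟨⟨τ₀, hτ₀⟩, fun hv u hvu hu => ?_, fun hv => ?_⟩
  · have huW : u ∈ W := by
      -- The maximality of `u` refers to the measures after the lifting, which differ from `ρ₀` only
      -- at `v`. If `u = v` is a self-loop, membership in `W` is already known.
      by_cases huv : u = v
      · exact huv ▸ hvW
      rcases lift_self ρ₀ v with ⟨ho, -⟩ | ⟨-, y, hvy, hy⟩
      · rw [hv] at ho
        exact Player.noConfusion ho
      -- Some successor `y` has progress value `⊤` and is saturated; `u` is at least as large. Here
      -- `y ≠ v`, as otherwise maximality would force `ρ₀ u = ⊤`.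
      apply hsat
      intro hlt
      have hyu := hu y hvy
      rw [lift_of_ne _ huv] at hyu
      have hyv : y ≠ v := by
        rintro rfl
        rw [hvtop, top_le_iff] at hyu
        exact htop u hyu
      rw [lift_of_ne _ hyv] at hyu
      exact hprog y (hmax _ (hy.symm.trans hvtop)) ((trunc_mono _ hyu).trans_lt hlt)
    have key := fun τ hτ => exists_winning_strategy hodd rfl hξ hAW hWk
      (fun h => absurd hv h) hvu huW (τ := τ) hτ
    obtain ⟨σ₀, hwin, hclosed, -⟩ := key τ₀ hτ₀
    refine ⟨W, ⟨σ₀.toStrategy, hwin, hclosed⟩, hAW, hWk, fun τ hτ => ?_⟩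
    obtain ⟨σ, h1, h2, h3, h4⟩ := key τ hτ
    exact ⟨σ, h1, h2, h3 hv, h4⟩
  · have hsucc : ∀ u, G.E v u → u ∈ W := by
      intro u hvu
      rcases lift_self ρ₀ v with ⟨-, y, -, hy, hmin⟩ | ⟨ho, -⟩
      -- The minimum over the successors is `⊤`, so every successor has progress value `⊤`.
      · apply hsat
        apply hprog
        have := hmin u hvu
        rwa [hmax _ (hy.symm.trans hvtop), top_le_iff] at this
      · rw [hv] at ho
        exact Player.noConfusion ho
    obtain ⟨u, hvu⟩ := G.total v
    have key := fun τ hτ => exists_winning_strategy hodd rfl hξ hAW hWk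
      (fun _ => hsucc) hvu (hsucc u hvu) (τ := τ) hτ
    obtain ⟨σ₀, hwin, hclosed, -⟩ := key τ₀ hτ₀
    refine ⟨W, ⟨σ₀.toStrategy, hwin, hclosed⟩, hAW, hWk, hsucc, fun τ hτ => ?_⟩
    obtain ⟨σ, h1, h2, -, h4⟩ := key τ hτ
    exact ⟨σ, h1, h2, h4⟩
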